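/- **Setting.** Let $\alpha\in(\tfrac12,\tfrac23)$. For each $n$ let $\Omega_n=\{x:[n]\to\{1,2\}\}$ be the set of all community assignment mappings (with no restriction on community sizes), and let $y=y_n\in\Omega_n$ be the true one, with $|y^{-1}(1)|=\lfloor\alpha n\rfloor$ and $|y^{-1}(2)|=n-\lfloor\alpha n\rfloor$. For $x\in\Omega_n$ let $\mathbf A_x\in\mathbb R^{n\times n}$ have entries $(\mathbf A_x)_{i,j}=1$ if $x(i)=x(j)$ and $0$ otherwise, and let $C(x)$ be the set of $x'\in\Omega_n$ with $\mathbf A_{x'}=\mathbf A_x$, i.e. those that induce the same partition of $[n]$ as $x$. Let $s=s_n>0$, let $\xi_1,\dots,\xi_n$ be i.i.d. $\mathcal N(0,s_n^2)$ random variables, and put $\mathbf W_{i,j}=\xi_i+\xi_j$ for $i,j\in[n]$. Let $\Sigma\in\mathbb R^{n^2\times n^2}$ be the covariance matrix of the entries of $\mathbf W$ and $\Sigma^\dagger$ its Moore–Penrose inverse. The observation is $\mathbf K_y=\mathbf A_y+\mathbf W$, and the maximum likelihood estimator (with unknown community sizes) is $$\hat y\in\operatorname*{argmin}_{x\in\Omega_n}\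 \sum_{i,j,k,l\in[n]}(\mathbf K_y-\mathbf A_x)_{i,j}\,(\Sigma^\dagger)_{i,j;k,l}\,(\mathbf K_y-\mathbf A_x)_{k,l},$$ where ties may be broken in an arbitrary way. **Theorem.** Let $\delta>0$ be a constant independent of $n$. 1. If $s_n>\dfrac{(1+\delta)(2\alpha-1)}{\sqrt{8\log n}}$ for all sufficiently large $n$, then $\lim_{n\to\infty}\Pr(\hat y\in C(y))=0$. 2. If $s_n<\dfrac{(1-\delta)(2\alpha-1)}{\sqrt{8\log n}}$ for all sufficiently large $n$, then $\lim_{n\to\infty}\Pr(\hat y\in C(y))=1$. Thus $\dfrac{2\alpha-1}{\sqrt{8\log n}}$ is a sharp threshold for the exact recovery of $y$ (up to relabelling the communities). -/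

import Mathlib

open MeasureTheory ProbabilityTheory Filter Topology

namespace VertexNoise

/-! ### The Moore-Penrose inverse of a real square matrix -/

/-- The four Penrose conditions: `B` is a Moore-Penrose inverse of `A`. -/
structure IsMoorePenroseInverse {ι : Type*} [Fintype ι] (A B : Matrix ι ι ℝ) : Prop where
  mul_mul_self : A * B * A = A
  self_mul_mul : B * A * B = B
  transpose_mul : (A * B).transpose = A * B
  mul_transpose : (B * A).transpose = B * A

/-- A matrix has at most one Moore-Penrose inverse. -/
theorem IsMoorePenroseInverse.unique {ι : Type*} [Fintype ι] {A B C : Matrix ι ι ℝ}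
    (hB : IsMoorePenroseInverse A B) (hC : IsMoorePenroseInverse A C) : B = C := by
  have h1 : A * B = A * C := by
    have e : A * C * (A * B) = A * B := by rw [← Matrix.mul_assoc, hC.mul_mul_self]
    have e' : A * B * (A * C) = A * C := by rw [← Matrix.mul_assoc, hB.mul_mul_self]
    have t := congrArg Matrix.transpose e
    rw [Matrix.transpose_mul, hB.transpose_mul, hC.transpose_mul, e'] at t
    exact t.symm
  have h2 : B * A = C * A := by
    have e : B * A * (C * A) = B * A := by
      rw [Matrix.mul_assoc, ← Matrix.mul_assoc A C A, hC.mul_mul_self]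
    have e' : C * A * (B * A) = C * A := by
      rw [Matrix.mul_assoc, ← Matrix.mul_assoc A B A, hB.mul_mul_self]
    have t := congrArg Matrix.transpose e
    rw [Matrix.transpose_mul, hB.mul_transpose, hC.mul_transpose, e'] at t
    exact t.symm
  calc B = B * A * B := hB.self_mul_mul.symm
    _ = C * A * C := by rw [Matrix.mul_assoc, h1, ← Matrix.mul_assoc, h2]
    _ = C := hC.self_mul_mul

/-- A real symmetric matrix has a Moore-Penrose inverse. -/
theorem exists_isMoorePenroseInverse {ι : Type*} [Fintype ι] {A : Matrix ι ι ℝ}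
    (hA : A.transpose = A) : ∃ B, IsMoorePenroseInverse A B := by
  classical
  have hH : A.IsHermitian := by
    rw [Matrix.IsHermitian, Matrix.conjTranspose_eq_transpose_of_trivial, hA]
  obtain ⟨U, d, hU, hAU⟩ : ∃ (U : Matrix ι ι ℝ) (d : ι → ℝ), U.transpose * U = 1 ∧
      A = U * Matrix.diagonal d * U.transpose := by
    refine ⟨hH.eigenvectorUnitary, hH.eigenvalues, ?_, ?_⟩
    · have := Unitary.coe_star_mul_self hH.eigenvectorUnitary
      rwa [Matrix.star_eq_conjTranspose, Matrix.conjTranspose_eq_transpose_of_trivial] at this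
    · have := hH.spectral_theorem
      rw [Unitary.conjStarAlgAut_apply, Matrix.star_eq_conjTranspose,
        Matrix.conjTranspose_eq_transpose_of_trivial] at this
      exact this
  have key : ∀ e f : ι → ℝ, U * Matrix.diagonal e * U.transpose *
      (U * Matrix.diagonal f * U.transpose) =
        U * Matrix.diagonal (fun i => e i * f i) * U.transpose := by
    intro e f
    rw [← Matrix.diagonal_mul_diagonal]
    calc _ = U * Matrix.diagonal e * (U.transpose * U) * Matrix.diagonal f * U.transpose := by
          simp only [Matrix.mul_assoc]
      _ = _ := by rw [hU, Matrix.mul_one]; simp only [Matrix.mul_assoc]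
  have tr : ∀ e : ι → ℝ, (U * Matrix.diagonal e * U.transpose).transpose =
      U * Matrix.diagonal e * U.transpose := by
    intro e
    simp [Matrix.transpose_mul, Matrix.mul_assoc]
  refine ⟨U * Matrix.diagonal (fun i => (d i)⁻¹) * U.transpose, ?_, ?_, ?_, ?_⟩
  · rw [hAU, key, key]
    congr; funext i
    by_cases h : d i = 0 <;> simp [h]
  · rw [hAU, key, key]
    congr; funext i
    by_cases h : d i = 0 <;> simp [h]
  · rw [hAU, key, tr]
  · rw [hAU, key, tr]

open Classical in
/-- The Moore-Penrose inverse of a square matrix (it always exists for symmetric matrices, the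
only ones to which it is applied; see `exists_isMoorePenroseInverse`). -/
noncomputable def moorePenrose {ι : Type*} [Fintype ι] (A : Matrix ι ι ℝ) : Matrix ι ι ℝ :=
  if h : ∃ B, IsMoorePenroseInverse A B then h.choose else 0

theorem moorePenrose_spec {ι : Type*} [Fintype ι] {A : Matrix ι ι ℝ}
    (hA : A.transpose = A) : IsMoorePenroseInverse A (moorePenrose A) := by
  have h := exists_isMoorePenroseInverse hA
  rw [moorePenrose, dif_pos h]
  exact h.choose_spec

/-! ### Community assignment mappings -/

/-- A community assignment mapping of `n` vertices to `k = 2` communities (either of which may be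
empty). The first community is `0`, the second one is `1`. -/
abbrev Assignment (n : ℕ) : Type := Fin n → Fin 2

/-- The number of vertices in community `a`. -/
def communitySize {n : ℕ} (x : Assignment n) (a : Fin 2) : ℕ :=
  (Finset.univ.filter fun v => x v = a).card

/-- `θ(x, i, a)` is `1` if vertex `i` lies in community `a` under `x`, and `0` otherwise. -/
def theta {n : ℕ} (x : Assignment n) (i : Fin n) (a : Fin 2) : ℝ :=
  if x i = a then 1 else 0

/-- The matrix `A_x`, with entries `θ(x, i, x(j))`, i.e. `1` if `x(i) = x(j)` and `0` otherwise. -/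
def signal {n : ℕ} (x : Assignment n) : Matrix (Fin n) (Fin n) ℝ :=
  Matrix.of fun i j => theta x i (x j)

/-- The class `C(x)` of all assignment mappings that are obtained from `x` by a `θ`-preserving
relabelling of the communities. -/
def equivClass {n : ℕ} (x : Assignment n) : Set (Assignment n) :=
  {x' | (∀ i j, x i = x j ↔ x' i = x' j) ∧ ∀ i j, theta x i (x j) = theta x' i (x' j)}

/-! ### Noise, observation and the maximum likelihood estimator -/

section Model

variable {Ω : Type*} [MeasurableSpace Ω] {n : ℕ}

/-- The noise matrix `W`, with entries `ξ_i + ξ_j`. -/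
def noise (ξ : Fin n → Ω → ℝ) (ω : Ω) : Matrix (Fin n) (Fin n) ℝ :=
  Matrix.of fun i j => ξ i ω + ξ j ω

/-- The observation `K_y = A_y + W`. -/
def observation (ξ : Fin n → Ω → ℝ) (y : Assignment n) (ω : Ω) : Matrix (Fin n) (Fin n) ℝ :=
  signal y + noise ξ ω

/-- The `n² × n²` covariance matrix `Σ` of the entries of `W`. -/
noncomputable def covMatrix (P : Measure Ω) (ξ : Fin n → Ω → ℝ) :
    Matrix (Fin n × Fin n) (Fin n × Fin n) ℝ :=
  Matrix.of fun p q =>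
    covariance (fun ω => noise ξ ω p.1 p.2) (fun ω => noise ξ ω q.1 q.2) P

theorem covMatrix_transpose (P : Measure Ω) (ξ : Fin n → Ω → ℝ) :
    (covMatrix P ξ).transpose = covMatrix P ξ := by
  ext p q
  exact covariance_comm _ _

/-- The quadratic form `∑ (K - A_x)_{i,j} (Σ†)_{i,j;k,l} (K - A_x)_{k,l}` of an observed matrix
`K`, where `Σ†` is the Moore-Penrose inverse of the covariance matrix of the noise. -/
noncomputable def objective (P : Measure Ω) (ξ : Fin n → Ω → ℝ)
    (K : Matrix (Fin n) (Fin n) ℝ) (x : Assignment n) : ℝ :=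
  ∑ i, ∑ j, ∑ k, ∑ l,
    (K - signal x) i j * moorePenrose (covMatrix P ξ) (i, j) (k, l) * (K - signal x) k l

/-- `z` is a maximum likelihood estimate for the observed matrix `K`, i.e. a minimizer of the
quadratic form above over all assignment mappings (no constraint on the community sizes). -/
def IsMLE (P : Measure Ω) (ξ : Fin n → Ω → ℝ)
    (K : Matrix (Fin n) (Fin n) ℝ) (z : Assignment n) : Prop :=
  ∀ x : Assignment n, objective P ξ K z ≤ objective P ξ K x

end Model

end VertexNoise

/-!
With `L v = (v i + v j)_{i,j}`, the noise matrix is `L ξ` and its covariance is `s² L Lᵀ`. As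
`LᵀL = 2n + 2J` is explicitly invertible for `n ≠ 0` (with `J` the all-ones matrix), the matrix
`D = (LᵀL)⁻¹Lᵀ` is explicit, and the Moore-Penrose inverse of the covariance is `s⁻² DᵀD` (`isMoorePenroseInverse_smul_pairSum`). The
quadratic form at `x` is therefore `s⁻² ‖ξ + g_y - g_x‖²`, a squared distance in `ℝⁿ`, where
`g_x = D A_x` takes one value on each community, and these two values depend only on the fraction `t`
of vertices in the first community (`pairFit_mulVec_signal`, `objective_observation`). For the true assignment
the two values differ by `c = 2t - 1`, which tends to `2α - 1`.

Above the threshold, exchanging a vertex `i` of the first community with a vertex `j` of the second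
one improves the fit as soon as `ξ j - ξ i > c` (`noise_sub_le_of_forall_le`). The largest value
of `ξ` in the second community and the largest value of `-ξ` in the first one are both about
`s √(2 log n)`, which exceeds `c / 2`; independence and the lower bound `le_measureReal_gt` on the Gaussian tail
turn this into `measureReal_mem_equivClass_le`.

Below the threshold, a union bound gives `|ξ v| ≤ m` for all `v`, with some `m < c / 2`, and the
mean square of the noise tends to `0`. These two facts imply recovery deterministically. If `x` fits
as well as `y`, then `g_x` and `g_y` are close in mean square, hence so are their means, which
determine the community sizes up to relabelling (`share_sub_share_le`). Up to errors controlled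
by the difference of the sizes, hence by the number `K` of vertices on which `x` and `y` differ, the
fit of `x` is worse than that of `y` by `K (c² - 2 m c)`, so that `K = 0` (`eq_of_fit_le`).
-/

namespace VertexNoise

/-! ### The Moore-Penrose inverse of the noise covariance -/

/-- The matrix of the linear map that sends a vector `v` to the `n × n` matrix with entries
`v i + v j`. -/
def pairSum (n : ℕ) : Matrix (Fin n × Fin n) (Fin n) ℝ :=
  Matrix.of fun p v => (if p.1 = v then 1 else 0) + (if p.2 = v then 1 else 0)

/-- The inverse of the Gram matrix `(pairSum n)ᵀ * pairSum n`, for `n ≠ 0`. -/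
noncomputable def gramInv (n : ℕ) : Matrix (Fin n) (Fin n) ℝ :=
  Matrix.of fun u v => (2 * n : ℝ)⁻¹ * ((if u = v then 1 else 0) - (2 * n : ℝ)⁻¹)

/-- The left inverse `(LᵀL)⁻¹Lᵀ` of `L = pairSum n`. -/
noncomputable def pairFit (n : ℕ) : Matrix (Fin n) (Fin n × Fin n) ℝ :=
  gramInv n * (pairSum n).transpose

theorem pairSum_mulVec {n : ℕ} (v : Fin n → ℝ) (p : Fin n × Fin n) :
    (pairSum n).mulVec v p = v p.1 + v p.2 := by
  simp [pairSum, Matrix.mulVec, dotProduct, add_mul, Finset.sum_add_distrib]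

theorem pairSum_transpose_mulVec {n : ℕ} (w : Fin n × Fin n → ℝ) (v : Fin n) :
    (pairSum n).transpose.mulVec w v = ∑ j, w (v, j) + ∑ i, w (i, v) := by
  simp [pairSum, Matrix.mulVec, dotProduct, add_mul, Finset.sum_add_distrib,
    Fintype.sum_prod_type]
  rw [Finset.sum_comm]
  simp

theorem gramInv_mulVec {n : ℕ} (z : Fin n → ℝ) (v : Fin n) :
    (gramInv n).mulVec z v = (2 * n : ℝ)⁻¹ * (z v - (2 * n : ℝ)⁻¹ * ∑ u, z u) := by
  simp [gramInv, Matrix.mulVec, dotProduct, mul_sub, sub_mul, Finset.sum_sub_distrib,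
    Finset.mul_sum, mul_assoc]

theorem gramInv_mulVec_eq {n : ℕ} (hn : n ≠ 0) {z g : Fin n → ℝ}
    (h : ∀ v, z v = 2 * n * g v + 2 * ∑ u, g u) : (gramInv n).mulVec z = g := by
  have hn' : (n : ℝ) ≠ 0 := by exact_mod_cast hn
  funext v
  rw [gramInv_mulVec, h]
  simp only [h, Finset.sum_add_distrib, ← Finset.mul_sum, Finset.sum_const, Finset.card_univ,
    Fintype.card_fin, nsmul_eq_mul]
  field_simp
  ring

theorem pairFit_mulVec {n : ℕ} (w : Fin n × Fin n → ℝ) :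
    (pairFit n).mulVec w = (gramInv n).mulVec ((pairSum n).transpose.mulVec w) := by
  rw [pairFit, Matrix.mulVec_mulVec]

theorem pairFit_mulVec_pairSum_mulVec {n : ℕ} (hn : n ≠ 0) (v : Fin n → ℝ) :
    (pairFit n).mulVec ((pairSum n).mulVec v) = v := by
  rw [pairFit_mulVec]
  refine gramInv_mulVec_eq hn fun u => ?_
  simp only [pairSum_transpose_mulVec, pairSum_mulVec, Finset.sum_add_distrib, Finset.sum_const,
    Finset.card_univ, Fintype.card_fin, nsmul_eq_mul]
  ring

theorem pairFit_mul_pairSum {n : ℕ} (hn : n ≠ 0) : pairFit n * pairSum n = 1 := by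
  refine Matrix.mulVec_injective (funext fun v => ?_)
  rw [← Matrix.mulVec_mulVec, pairFit_mulVec_pairSum_mulVec hn, Matrix.one_mulVec]

theorem gramInv_transpose (n : ℕ) : (gramInv n).transpose = gramInv n := by
  ext u v
  simp [gramInv, eq_comm]

theorem pairSum_mul_pairFit_transpose (n : ℕ) :
    (pairSum n * pairFit n).transpose = pairSum n * pairFit n := by
  simp [pairFit, Matrix.transpose_mul, gramInv_transpose, Matrix.mul_assoc]

/-- With `L = pairSum n` and `D = pairFit n`, this holds because `D L = 1` and `L D`
is symmetric. -/
theorem isMoorePenroseInverse_smul_pairSum {n : ℕ} (hn : n ≠ 0) {r : ℝ} (hr : r ≠ 0) :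
    IsMoorePenroseInverse (r • (pairSum n * (pairSum n).transpose))
      (r⁻¹ • ((pairFit n).transpose * pairFit n)) := by
  have h1 := pairFit_mul_pairSum hn
  have h2 : (pairSum n).transpose * (pairFit n).transpose = 1 := by
    rw [← Matrix.transpose_mul, h1, Matrix.transpose_one]
  have h3 := pairSum_mul_pairFit_transpose n
  have hAB : r • (pairSum n * (pairSum n).transpose) * (r⁻¹ • ((pairFit n).transpose * pairFit n))
      = pairSum n * pairFit n := by
    rw [Matrix.smul_mul, Matrix.mul_smul, smul_smul, mul_inv_cancel₀ hr, one_smul,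
      Matrix.mul_assoc, ← Matrix.mul_assoc (pairSum n).transpose, h2, Matrix.one_mul]
  have hBA : r⁻¹ • ((pairFit n).transpose * pairFit n) * (r • (pairSum n * (pairSum n).transpose))
      = pairSum n * pairFit n := by
    rw [Matrix.smul_mul, Matrix.mul_smul, smul_smul, inv_mul_cancel₀ hr, one_smul,
      Matrix.mul_assoc, ← Matrix.mul_assoc (pairFit n), h1, Matrix.one_mul,
      ← Matrix.transpose_mul, h3]
  refine ⟨?_, ?_, ?_, ?_⟩
  · rw [hAB, Matrix.mul_smul, Matrix.mul_assoc, ← Matrix.mul_assoc (pairFit n), h1,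
      Matrix.one_mul]
  · rw [hBA, ← h3, Matrix.transpose_mul, Matrix.mul_smul, Matrix.mul_assoc,
      ← Matrix.mul_assoc (pairSum n).transpose, h2, Matrix.one_mul]
  · rw [hAB, h3]
  · rw [hBA, h3]

section Model

variable {Ω : Type*} [MeasurableSpace Ω] {n : ℕ}

theorem covariance_of_iIndepFun_gaussian {P : Measure Ω} [IsProbabilityMeasure P]
    {ξ : Fin n → Ω → ℝ} {s : ℝ}
    (hlaw : ∀ v, HasLaw (ξ v) (gaussianReal 0 (Real.toNNReal (s ^ 2))) P)
    (hindep : iIndepFun ξ P) (hL : ∀ v, MemLp (ξ v) 2 P) (i j : Fin n) :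
    covariance (ξ i) (ξ j) P = s ^ 2 * (if i = j then 1 else 0) := by
  split_ifs with h
  · subst h
    rw [covariance_self (hlaw i).aemeasurable, (hlaw i).variance_eq, variance_id_gaussianReal]
    simp [Real.coe_toNNReal _ (sq_nonneg s)]
  · rw [(hindep.indepFun h).covariance_eq_zero (hL i) (hL j), mul_zero]

theorem memLp_two_of_hasLaw_gaussianReal {P : Measure Ω} {X : Ω → ℝ} {v : NNReal}
    (h : HasLaw X (gaussianReal 0 v) P) : MemLp X 2 P := by
  have := memLp_id_gaussianReal (μ := 0) (v := v) 2
  rw [← h.map_eq] at this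
  exact (memLp_map_measure_iff aestronglyMeasurable_id h.aemeasurable).1 this

theorem covMatrix_eq {P : Measure Ω} [IsProbabilityMeasure P] {ξ : Fin n → Ω → ℝ} {s : ℝ}
    (hlaw : ∀ v, HasLaw (ξ v) (gaussianReal 0 (Real.toNNReal (s ^ 2))) P)
    (hindep : iIndepFun ξ P) :
    covMatrix P ξ = s ^ 2 • (pairSum n * (pairSum n).transpose) := by
  have hL v := memLp_two_of_hasLaw_gaussianReal (hlaw v)
  have hc := covariance_of_iIndepFun_gaussian hlaw hindep hL
  ext ⟨i, j⟩ ⟨k, l⟩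
  have h1 : covMatrix P ξ (i, j) (k, l) = covariance (ξ i + ξ j) (ξ k + ξ l) P := rfl
  rw [h1, covariance_add_left (hL i) (hL j) ((hL k).add (hL l)),
    covariance_add_right (hL i) (hL k) (hL l), covariance_add_right (hL j) (hL k) (hL l)]
  simp only [hc, pairSum, Matrix.smul_apply, Matrix.mul_apply, Matrix.transpose_apply,
    Matrix.of_apply, smul_eq_mul, add_mul, mul_add, Finset.sum_add_distrib, ite_mul, one_mul,
    zero_mul, Finset.sum_ite_eq, Finset.mem_univ, if_true, eq_comm]
  ring

theorem objective_eq {P : Measure Ω} [IsProbabilityMeasure P] {ξ : Fin n → Ω → ℝ} {s : ℝ}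
    (hs : s ≠ 0) (hn : n ≠ 0)
    (hlaw : ∀ v, HasLaw (ξ v) (gaussianReal 0 (Real.toNNReal (s ^ 2))) P)
    (hindep : iIndepFun ξ P) (K : Matrix (Fin n) (Fin n) ℝ) (x : Assignment n) :
    objective P ξ K x =
      (s ^ 2)⁻¹ * ∑ v, ((pairFit n).mulVec (fun p => (K - signal x) p.1 p.2) v) ^ 2 := by
  have hmp : moorePenrose (covMatrix P ξ) = (s ^ 2)⁻¹ • ((pairFit n).transpose * pairFit n) := by
    refine (moorePenrose_spec (covMatrix_transpose P ξ)).unique ?_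
    rw [covMatrix_eq hlaw hindep]
    exact isMoorePenroseInverse_smul_pairSum hn (pow_ne_zero 2 hs)
  set w : Fin n × Fin n → ℝ := fun p => (K - signal x) p.1 p.2 with hw
  have h1 : objective P ξ K x = w ⬝ᵥ (moorePenrose (covMatrix P ξ)).mulVec w := by
    simp only [objective, dotProduct, Matrix.mulVec, Fintype.sum_prod_type, Finset.mul_sum, hw,
      mul_assoc]
  rw [h1, hmp, Matrix.smul_mulVec, dotProduct_smul, ← Matrix.mulVec_mulVec,
    Matrix.dotProduct_mulVec, Matrix.vecMul_transpose, smul_eq_mul]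
  simp only [dotProduct, sq]

end Model

/-! ### The fitted profile of an assignment -/

/-- The fraction of vertices in the first community. -/
noncomputable def share {n : ℕ} (x : Assignment n) : ℝ := communitySize x 0 / n

/-- The vector `g` for which the matrix `(g i + g j)` is the least-squares approximation of `A_x`
by matrices of this form (see `pairFit_mulVec_signal`). -/
noncomputable def profile {n : ℕ} (x : Assignment n) (v : Fin n) : ℝ :=
  if x v = 0 then 2 * share x - share x ^ 2 - 1 / 2 else 1 / 2 - share x ^ 2

theorem communitySize_zero_add_one {n : ℕ} (x : Assignment n) :
    communitySize x 0 + communitySize x 1 = n := by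
  have h := Finset.card_eq_sum_card_fiberwise (f := x) (s := Finset.univ) (t := Finset.univ)
    (fun _ _ => Finset.mem_coe.2 (Finset.mem_univ _))
  rw [Finset.card_univ, Fintype.card_fin, Fin.sum_univ_two] at h
  exact h.symm

theorem sum_ite_zero {n : ℕ} (x : Assignment n) (p q : ℝ) :
    ∑ v, (if x v = 0 then p else q) = n * (share x * p + (1 - share x) * q) := by
  rcases Nat.eq_zero_or_pos n with rfl | hn
  · simp
  have hn' : (n : ℝ) ≠ 0 := by positivity
  have h0 : ∑ v, (if x v = 0 then (1 : ℝ) else 0) = communitySize x 0 := by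
    simp [communitySize]
  have h1 : ∀ v, (if x v = 0 then p else q) = q + (p - q) * (if x v = 0 then 1 else 0) := by
    intro v; split_ifs <;> ring
  simp only [h1, Finset.sum_add_distrib, ← Finset.mul_sum, h0, Finset.sum_const,
    Finset.card_univ, Fintype.card_fin, nsmul_eq_mul, share]
  field_simp
  ring

theorem sum_profile {n : ℕ} (x : Assignment n) :
    ∑ v, profile x v = n * (share x ^ 2 - share x + 1 / 2) := by
  simp only [profile, sum_ite_zero]
  ring

theorem signal_symm {n : ℕ} (x : Assignment n) (i j : Fin n) : signal x i j = signal x j i := by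
  simp [signal, theta, eq_comm]

theorem sum_signal {n : ℕ} (x : Assignment n) (i : Fin n) :
    ∑ j, signal x i j = if x i = 0 then n * share x else n * (1 - share x) := by
  have h : ∀ a : Fin 2, a ≠ 0 → a = 1 := by decide
  split_ifs with hi
  · rw [show n * share x = n * (share x * 1 + (1 - share x) * 0) by ring, ← sum_ite_zero]
    simp [signal, theta, hi, eq_comm]
  · rw [show n * (1 - share x) = n * (share x * 0 + (1 - share x) * 1) by ring, ← sum_ite_zero]
    refine Finset.sum_congr rfl fun j _ => ?_
    rw [h _ hi |> fun e => show signal x i j = if (1 : Fin 2) = x j then 1 else 0 by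
      simp [signal, theta, e]]
    by_cases hj : x j = 0
    · simp [hj]
    · simp [h _ hj]

theorem pairFit_mulVec_signal {n : ℕ} (hn : n ≠ 0) (x : Assignment n) :
    (pairFit n).mulVec (fun p => signal x p.1 p.2) = profile x := by
  rw [pairFit_mulVec]
  refine gramInv_mulVec_eq hn fun v => ?_
  rw [pairSum_transpose_mulVec]
  simp only [signal_symm x _ v, sum_signal, sum_profile]
  unfold profile
  split_ifs <;> ring

theorem profile_congr {n : ℕ} {x x' : Assignment n} (h : signal x = signal x') :
    profile x = profile x' := by
  rcases Nat.eq_zero_or_pos n with rfl | hn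
  · exact funext fun v => v.elim0
  · rw [← pairFit_mulVec_signal hn.ne', h, pairFit_mulVec_signal hn.ne']

/-- Since the noise lies in the range of `pairSum`, the quadratic form is, up to the factor
`s⁻²`, a squared Euclidean distance in `ℝⁿ`. -/
theorem objective_observation {Ω : Type*} [MeasurableSpace Ω] {n : ℕ} {P : Measure Ω}
    [IsProbabilityMeasure P] {ξ : Fin n → Ω → ℝ} {s : ℝ} (hs : s ≠ 0) (hn : n ≠ 0)
    (hlaw : ∀ v, HasLaw (ξ v) (gaussianReal 0 (Real.toNNReal (s ^ 2))) P)
    (hindep : iIndepFun ξ P) (y x : Assignment n) (ω : Ω) :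
    objective P ξ (observation ξ y ω) x =
      (s ^ 2)⁻¹ * ∑ v, (ξ v ω + (profile y v - profile x v)) ^ 2 := by
  rw [objective_eq hs hn hlaw hindep]
  have h : (fun p : Fin n × Fin n => (observation ξ y ω - signal x) p.1 p.2) =
      (pairSum n).mulVec (fun v => ξ v ω) +
        ((fun p => signal y p.1 p.2) - fun p => signal x p.1 p.2) := by
    funext p
    simp only [observation, noise, Matrix.sub_apply, Matrix.add_apply, Matrix.of_apply,
      Pi.add_apply, Pi.sub_apply, pairSum_mulVec]
    ring
  rw [h, Matrix.mulVec_add, Matrix.mulVec_sub, pairFit_mulVec_pairSum_mulVec hn,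
    pairFit_mulVec_signal hn, pairFit_mulVec_signal hn]
  rfl

/-! ### Relabelling and swapping -/

theorem mem_equivClass_iff {n : ℕ} {y z : Assignment n} :
    z ∈ equivClass y ↔ signal z = signal y := by
  constructor
  · rintro ⟨-, h⟩
    ext i j
    exact (h i j).symm
  · intro h
    have h' : ∀ i j, theta y i (y j) = theta z i (z j) := fun i j => (congrFun₂ h i j).symm
    refine ⟨fun i j => ?_, h'⟩
    have := h' i j
    unfold theta at this
    by_cases h1 : y i = y j <;> by_cases h2 : z i = z j <;> simp_all

/-- The assignment with the two community labels exchanged. -/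
def relabel {n : ℕ} (x : Assignment n) : Assignment n := fun v => 1 - x v

theorem signal_relabel {n : ℕ} (x : Assignment n) : signal (relabel x) = signal x := by
  ext i j
  simp [signal, theta, relabel]

theorem share_relabel {n : ℕ} (hn : n ≠ 0) (x : Assignment n) :
    share (relabel x) = 1 - share x := by
  have hn' : (n : ℝ) ≠ 0 := by exact_mod_cast hn
  have e : ∀ a : Fin 2, (if 1 - a = 0 then (1 : ℝ) else 0) = if a = 0 then 0 else 1 := by
    intro a; fin_cases a <;> simp
  have h : ∑ v, (if relabel x v = 0 then (1 : ℝ) else 0) = ∑ v, if x v = 0 then 0 else 1 :=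
    Finset.sum_congr rfl fun v _ => e (x v)
  rw [sum_ite_zero, sum_ite_zero] at h
  have := mul_left_cancel₀ hn' h
  linarith

theorem share_nonneg {n : ℕ} (x : Assignment n) : 0 ≤ share x := by
  unfold share; positivity

theorem share_le_one {n : ℕ} (x : Assignment n) : share x ≤ 1 := by
  refine div_le_one_of_le₀ ?_ (Nat.cast_nonneg n)
  exact_mod_cast (Nat.le_add_right _ _).trans (communitySize_zero_add_one x).le

/-- The difference at `v` of the indicators of the first community under `y` and under `x`. -/
def labelDiff {n : ℕ} (y x : Assignment n) (v : Fin n) : ℝ :=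
  (if y v = 0 then 1 else 0) - (if x v = 0 then 1 else 0)

theorem sum_labelDiff {n : ℕ} (y x : Assignment n) :
    ∑ v, labelDiff y x v = n * (share y - share x) := by
  simp only [labelDiff, Finset.sum_sub_distrib, sum_ite_zero]
  ring

theorem abs_labelDiff {n : ℕ} (y x : Assignment n) (v : Fin n) :
    |labelDiff y x v| = labelDiff y x v ^ 2 := by
  unfold labelDiff
  split_ifs <;> norm_num

theorem eq_of_labelDiff_eq_zero {n : ℕ} {y x : Assignment n} (h : ∀ v, labelDiff y x v = 0) :
    x = y := by
  have e : ∀ a b : Fin 2, (a = 0 ↔ b = 0) → a = b := by decide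
  funext v
  refine e _ _ ?_
  have := h v
  unfold labelDiff at this
  by_cases h1 : y v = 0 <;> by_cases h2 : x v = 0 <;> simp_all

/-- The profiles of `y` and `x` differ by a multiple of `labelDiff y x` and a term that is small
when the community sizes are close. -/
theorem profile_sub_profile {n : ℕ} (y x : Assignment n) (v : Fin n) :
    profile y v - profile x v = (2 * share y - 1) * labelDiff y x v +
      (share y - share x) *
        (if x v = 0 then 2 - (share y + share x) else -(share y + share x)) := by
  unfold profile labelDiff
  split_ifs <;> ring

/-- If `y` itself is a best fit, then exchanging a vertex `i` of the first community with a vertex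
`j` of the second one does not improve it; this keeps the community sizes, so only the terms of `i`
and `j` change. -/
theorem noise_sub_le_of_forall_le {n : ℕ} {y : Assignment n} {ξ : Fin n → ℝ}
    (hc : 0 < 2 * share y - 1)
    (h : ∀ x, ∑ v, ξ v ^ 2 ≤ ∑ v, (ξ v + (profile y v - profile x v)) ^ 2)
    {i j : Fin n} (hi : y i = 0) (hj : y j ≠ 0) : ξ j - ξ i ≤ 2 * share y - 1 := by
  have hij : i ≠ j := by rintro rfl; exact hj hi
  set x : Assignment n := y ∘ Equiv.swap i j with hx
  have hxv : ∀ v, (if x v = 0 then (1 : ℝ) else 0) =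
      (fun w => if y w = 0 then (1 : ℝ) else 0) (Equiv.swap i j v) := fun v => rfl
  have hshare : n * (share y - share x) = 0 := by
    rw [← sum_labelDiff]
    simp only [labelDiff, Finset.sum_sub_distrib, hxv]
    rw [Equiv.sum_comp (Equiv.swap i j) (fun w => if y w = 0 then (1 : ℝ) else 0), sub_self]
  have hshare : share y - share x = 0 := by
    have : (n : ℝ) ≠ 0 := by
      have := i.pos
      positivity
    simpa [this] using hshare
  have hli : labelDiff y x i = 1 := by simp [labelDiff, hx, hi, hj]
  have hlj : labelDiff y x j = -1 := by simp [labelDiff, hx, hi, hj]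
  have hlv : ∀ v, v ≠ i ∧ v ≠ j → labelDiff y x v = 0 := by
    rintro v ⟨h1, h2⟩
    simp [labelDiff, hx, Equiv.swap_apply_of_ne_of_ne h1 h2]
  have h0 : 0 ≤ ∑ v, ((ξ v + (profile y v - profile x v)) ^ 2 - ξ v ^ 2) := by
    rw [Finset.sum_sub_distrib]
    exact sub_nonneg.2 (h x)
  rw [Finset.sum_eq_add i j hij
    (fun v _ hv => by rw [profile_sub_profile, hlv v hv, hshare]; ring)
    (fun hi => absurd (Finset.mem_univ _) hi) (fun hj => absurd (Finset.mem_univ _) hj),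
    profile_sub_profile, profile_sub_profile, hli, hlj, hshare] at h0
  nlinarith

/-! ### Small noise forces exact recovery -/

/-- An assignment that fits at least as well as `y` has nearly the same community sizes: its profile
is close to that of `y` in mean square, hence in mean, and the mean of the profile is increasing in
the share for shares above `1 / 2`. -/
theorem share_sub_share_le {n : ℕ} (hn : n ≠ 0) {y x : Assignment n} {ξ : Fin n → ℝ} {e : ℝ}
    (he : 0 ≤ e) (hc : 0 < 2 * share y - 1) (hx : 1 / 2 ≤ share x)
    (hξ : ∑ v, ξ v ^ 2 ≤ e ^ 2 * n)
    (h : ∑ v, (ξ v + (profile y v - profile x v)) ^ 2 ≤ ∑ v, ξ v ^ 2) :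
    (2 * share y - 1) * |share y - share x| ≤ 4 * e := by
  have hn' : (0 : ℝ) < n := by positivity
  set d : Fin n → ℝ := fun v => profile y v - profile x v
  have h1 : ∑ v, d v ^ 2 ≤ 4 * e ^ 2 * n := by
    have : ∑ v, d v ^ 2 ≤ ∑ v, (2 * (ξ v + d v) ^ 2 + 2 * ξ v ^ 2) :=
      Finset.sum_le_sum fun v _ => by nlinarith [sq_nonneg (2 * ξ v + d v)]
    rw [Finset.sum_add_distrib, ← Finset.mul_sum, ← Finset.mul_sum] at this
    linarith
  have h2 : (∑ v, d v) ^ 2 ≤ (2 * e * n) ^ 2 := by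
    have : (∑ v, d v) ^ 2 ≤ n * ∑ v, d v ^ 2 := by
      simpa using sq_sum_le_card_mul_sum_sq (s := Finset.univ) (f := d)
    nlinarith
  have h3 : ∑ v, d v = n * ((share y - share x) * (share y + share x - 1)) := by
    rw [Finset.sum_sub_distrib, sum_profile, sum_profile]
    ring
  have h5 : |∑ v, d v| ≤ 2 * e * n := abs_le_of_sq_le_sq h2 (by positivity)
  rw [h3, abs_mul, abs_mul, abs_of_pos hn', abs_of_pos (by linarith : 0 < share y + share x - 1),
    mul_comm, mul_le_mul_iff_left₀ hn'] at h5
  nlinarith [abs_nonneg (share y - share x)]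

/-- The excess of the squared distance of `x` over that of `y` is at least a positive multiple of
the number of vertices on which `x` and `y` differ. In the constant `20 * e`, a part `16 * e` pays
for the product of the two terms in `profile_sub_profile`, and `4 * e` for the effect of the noise on
the second of them. -/
theorem eq_of_fit_le {n : ℕ} (hn : n ≠ 0) {y x : Assignment n} {ξ : Fin n → ℝ} {e m : ℝ}
    (he : 0 ≤ e) (hc : 0 < 2 * share y - 1) (hx : 1 / 2 ≤ share x)
    (hm : ∀ v, |ξ v| ≤ m) (hξ : ∑ v, ξ v ^ 2 ≤ e ^ 2 * n)
    (hgap : 0 < (2 * share y - 1) ^ 2 - 2 * m * (2 * share y - 1) - 20 * e)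
    (h : ∑ v, (ξ v + (profile y v - profile x v)) ^ 2 ≤ ∑ v, ξ v ^ 2) : x = y := by
  have hn' : (0 : ℝ) < n := by positivity
  set c := 2 * share y - 1 with hc'
  set τ := share y - share x with hτ
  set K := ∑ v, labelDiff y x v ^ 2 with hK
  have hK0 : 0 ≤ K := Finset.sum_nonneg fun v _ => sq_nonneg _
  have hcτ : c * |τ| ≤ 4 * e := share_sub_share_le hn he hc hx hξ h
  have hτK : n * |τ| ≤ K := by
    rw [← abs_of_pos hn', ← abs_mul, ← sum_labelDiff]
    refine (Finset.abs_sum_le_sum_abs _ _).trans_eq ?_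
    simp only [abs_labelDiff, hK]
  have hS : ∑ v, |ξ v| ≤ e * n := by
    refine abs_le_of_sq_le_sq' ?_ (by positivity) |>.2
    have : (∑ v, |ξ v|) ^ 2 ≤ n * ∑ v, |ξ v| ^ 2 := by
      simpa using sq_sum_le_card_mul_sum_sq (s := Finset.univ) (f := fun v => |ξ v|)
    simp only [sq_abs] at this
    nlinarith
  have hpt : ∀ v, (c ^ 2 - 2 * m * c - 4 * (c * |τ|)) * labelDiff y x v ^ 2 - 4 * |τ| * |ξ v| ≤
      (ξ v + (profile y v - profile x v)) ^ 2 - ξ v ^ 2 := by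
    intro v
    rw [profile_sub_profile]
    set u := labelDiff y x v with hu
    set w := if x v = 0 then 2 - (share y + share x) else -(share y + share x) with hw
    have hw2 : |w| ≤ 2 := by
      have := share_nonneg y; have := share_nonneg x
      have := share_le_one y; have := share_le_one x
      rw [hw, abs_le]
      split_ifs <;> constructor <;> linarith
    have hu2 : |u| = u ^ 2 := abs_labelDiff y x v
    have e1 : -(m * u ^ 2) ≤ ξ v * u := by
      have h1 : |ξ v * u| ≤ m * u ^ 2 := by
        rw [abs_mul, ← hu2]
        exact mul_le_mul_of_nonneg_right (hm v) (abs_nonneg u)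
      exact (abs_le.1 h1).1
    have e2 : -(2 * |τ| * |ξ v|) ≤ τ * w * ξ v := by
      have h1 : |τ * w * ξ v| ≤ 2 * |τ| * |ξ v| := by
        rw [abs_mul, abs_mul]
        refine mul_le_mul_of_nonneg_right ?_ (abs_nonneg _)
        rw [mul_comm 2]
        exact mul_le_mul_of_nonneg_left hw2 (abs_nonneg _)
      exact (abs_le.1 h1).1
    have e3 : -(2 * |τ| * u ^ 2) ≤ τ * w * u := by
      have h1 : |τ * w * u| ≤ 2 * |τ| * u ^ 2 := by
        rw [abs_mul, abs_mul, ← hu2]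
        refine mul_le_mul_of_nonneg_right ?_ (abs_nonneg _)
        rw [mul_comm 2]
        exact mul_le_mul_of_nonneg_left hw2 (abs_nonneg _)
      exact (abs_le.1 h1).1
    have e4 := mul_le_mul_of_nonneg_left e1 hc.le
    have e5 := mul_le_mul_of_nonneg_left e3 hc.le
    nlinarith [sq_nonneg (τ * w)]
  have hsum := Finset.sum_le_sum fun v (_ : v ∈ Finset.univ) => hpt v
  rw [Finset.sum_sub_distrib, Finset.sum_sub_distrib, ← Finset.mul_sum, ← Finset.mul_sum,
    ← hK] at hsum
  have h6 : |τ| * ∑ v, |ξ v| ≤ e * K :=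
    calc |τ| * ∑ v, |ξ v| ≤ |τ| * (e * n) := mul_le_mul_of_nonneg_left hS (abs_nonneg _)
      _ = e * (n * |τ|) := by ring
      _ ≤ e * K := mul_le_mul_of_nonneg_left hτK he
  have hKle : K ≤ 0 := by
    by_contra hpos
    push Not at hpos
    nlinarith [mul_le_mul_of_nonneg_right hcτ hK0, mul_pos hgap hpos]
  have hK' : K = 0 := le_antisymm hKle hK0
  rw [hK, Finset.sum_eq_zero_iff_of_nonneg fun v _ => sq_nonneg _] at hK'
  exact eq_of_labelDiff_eq_zero fun v =>
    pow_eq_zero_iff two_ne_zero |>.1 (hK' v (Finset.mem_univ v))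

/-- Since relabelling does not change the profile, the assumption `1 / 2 ≤ share x` of
`eq_of_fit_le` costs nothing. -/
theorem mem_equivClass_of_fit_le {n : ℕ} (hn : n ≠ 0) {y x : Assignment n} {ξ : Fin n → ℝ}
    {e m : ℝ} (he : 0 ≤ e) (hc : 0 < 2 * share y - 1)
    (hm : ∀ v, |ξ v| ≤ m) (hξ : ∑ v, ξ v ^ 2 ≤ e ^ 2 * n)
    (hgap : 0 < (2 * share y - 1) ^ 2 - 2 * m * (2 * share y - 1) - 20 * e)
    (h : ∑ v, (ξ v + (profile y v - profile x v)) ^ 2 ≤ ∑ v, ξ v ^ 2) : x ∈ equivClass y := by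
  rw [mem_equivClass_iff]
  rcases le_total (1 / 2) (share x) with hx | hx
  · rw [eq_of_fit_le hn he hc hx hm hξ hgap h]
  · rw [← signal_relabel x]
    refine congrArg signal (eq_of_fit_le hn he hc ?_ hm hξ hgap ?_)
    · rw [share_relabel hn]
      linarith
    · rwa [profile_congr (signal_relabel x)]

/-! ### Tails of Gaussian variables -/

section Tails

variable {Ω : Type*} [MeasurableSpace Ω] {P : Measure Ω} {s : ℝ}

theorem hasSubgaussianMGF_of_hasLaw_gaussianReal {X : Ω → ℝ} {v : NNReal}
    (h : HasLaw X (gaussianReal 0 v) P) : HasSubgaussianMGF X v P where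
  integrable_exp_mul t := by
    have hi : Integrable (fun x => Real.exp (t * x)) (P.map X) := by
      rw [h.map_eq]
      exact integrable_exp_mul_gaussianReal t
    exact hi.comp_aemeasurable h.aemeasurable
  mgf_le t := by
    rw [mgf_gaussianReal h.map_eq, zero_mul, zero_add]

theorem measureReal_le_abs_le [IsProbabilityMeasure P] {X : Ω → ℝ}
    (h : HasLaw X (gaussianReal 0 (Real.toNNReal (s ^ 2))) P) {m : ℝ} (hm : 0 ≤ m) :
    P.real {ω | m ≤ |X ω|} ≤ 2 * Real.exp (-m ^ 2 / (2 * s ^ 2)) := by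
  have hneg : HasLaw (-X) (gaussianReal 0 (Real.toNNReal (s ^ 2))) P := by
    simpa using gaussianReal_neg h
  have h1 := (hasSubgaussianMGF_of_hasLaw_gaussianReal h).measure_ge_le hm
  have h2 := (hasSubgaussianMGF_of_hasLaw_gaussianReal hneg).measure_ge_le hm
  rw [Real.coe_toNNReal _ (sq_nonneg s)] at h1 h2
  calc P.real {ω | m ≤ |X ω|} ≤ P.real ({ω | m ≤ X ω} ∪ {ω | m ≤ (-X) ω}) :=
        measureReal_mono fun ω (hω : m ≤ |X ω|) => (le_abs.1 hω : m ≤ X ω ∨ m ≤ -X ω)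
    _ ≤ _ := (measureReal_union_le _ _).trans (by linarith)

theorem le_measureReal_gt [IsProbabilityMeasure P] (hs : 0 < s) {X : Ω → ℝ}
    (h : HasLaw X (gaussianReal 0 (Real.toNNReal (s ^ 2))) P) {u : ℝ} (hu : 0 ≤ u) :
    (√(2 * Real.pi))⁻¹ * Real.exp (-(u / s + 1) ^ 2 / 2) ≤ P.real {ω | u < X ω} := by
  have hv : Real.toNNReal (s ^ 2) ≠ 0 := by
    rw [Ne, Real.toNNReal_eq_zero, not_le]
    positivity
  have h1 : P.real {ω | u < X ω} =
      ∫ x in Set.Ioi u, gaussianPDFReal 0 (Real.toNNReal (s ^ 2)) x := by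
    rw [h.measureReal_eq (p := fun x => u < x) measurableSet_Ioi]
    change (gaussianReal 0 (Real.toNNReal (s ^ 2))).real (Set.Ioi u) = _
    rw [measureReal_def, gaussianReal_apply_eq_integral _ hv, ENNReal.toReal_ofReal]
    exact integral_nonneg fun x => gaussianPDFReal_nonneg _ _ _
  have hint := integrable_gaussianPDFReal 0 (Real.toNNReal (s ^ 2))
  -- On `(u, u + s]` the density is at least its value at `u + s`.
  have hlow : ∀ x ∈ Set.Ioc u (u + s),
      s⁻¹ * ((√(2 * Real.pi))⁻¹ * Real.exp (-(u / s + 1) ^ 2 / 2)) ≤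
        gaussianPDFReal 0 (Real.toNNReal (s ^ 2)) x := by
    rintro x ⟨hx1, hx2⟩
    rw [gaussianPDFReal_def]
    simp only [Real.coe_toNNReal _ (sq_nonneg s), sub_zero]
    rw [Real.sqrt_mul (by positivity : 0 ≤ 2 * Real.pi) (s ^ 2), Real.sqrt_sq hs.le,
      mul_inv, ← mul_assoc, mul_comm s⁻¹]
    refine mul_le_mul_of_nonneg_left (Real.exp_le_exp.2 ?_) (by positivity)
    have e : (u / s + 1) ^ 2 / 2 = (u + s) ^ 2 / (2 * s ^ 2) := by
      field_simp
    rw [neg_div, neg_div, e, neg_le_neg_iff]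
    gcongr
    exact hu.trans hx1.le
  calc (√(2 * Real.pi))⁻¹ * Real.exp (-(u / s + 1) ^ 2 / 2)
      = ∫ x in Set.Ioc u (u + s),
          s⁻¹ * ((√(2 * Real.pi))⁻¹ * Real.exp (-(u / s + 1) ^ 2 / 2)) := by
        rw [setIntegral_const, smul_eq_mul, measureReal_def, Real.volume_Ioc, add_sub_cancel_left,
          ENNReal.toReal_ofReal hs.le, mul_inv_cancel_left₀ hs.ne']
    _ ≤ ∫ x in Set.Ioc u (u + s), gaussianPDFReal 0 (Real.toNNReal (s ^ 2)) x :=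
        setIntegral_mono_on (integrableOn_const (by simp)) hint.integrableOn measurableSet_Ioc hlow
    _ ≤ ∫ x in Set.Ioi u, gaussianPDFReal 0 (Real.toNNReal (s ^ 2)) x :=
        setIntegral_mono_set hint.integrableOn
          (ae_of_all _ fun x => gaussianPDFReal_nonneg _ _ _)
          (LE.le.eventuallyLE Set.Ioc_subset_Ioi_self)
    _ = P.real {ω | u < X ω} := h1.symm

theorem measureReal_forall_le [IsProbabilityMeasure P] {ι : Type*} (S : Finset ι)
    {X : ι → Ω → ℝ} (hs : 0 < s)
    (hlaw : ∀ v, HasLaw (X v) (gaussianReal 0 (Real.toNNReal (s ^ 2))) P)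
    (hindep : iIndepFun X P) {u : ℝ} (hu : 0 ≤ u) :
    P.real {ω | ∀ v ∈ S, X v ω ≤ u} ≤
      Real.exp (-(S.card * ((√(2 * Real.pi))⁻¹ * Real.exp (-(u / s + 1) ^ 2 / 2)))) := by
  set q := (√(2 * Real.pi))⁻¹ * Real.exp (-(u / s + 1) ^ 2 / 2)
  have h1 : {ω | ∀ v ∈ S, X v ω ≤ u} = ⋂ v ∈ S, X v ⁻¹' Set.Iic u := by
    ext ω
    simp
  have h2 : ∀ v, P.real (X v ⁻¹' Set.Iic u) ≤ Real.exp (-q) := by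
    intro v
    have hq : q ≤ P.real {ω | u < X v ω} := le_measureReal_gt hs (hlaw v) hu
    have hc : P.real {ω | u < X v ω} = 1 - P.real (X v ⁻¹' Set.Iic u) := by
      rw [← probReal_compl_eq_one_sub₀
        ((hlaw v).aemeasurable.nullMeasurableSet_preimage measurableSet_Iic)]
      congr 1
      ext ω
      simp
    linarith [Real.one_sub_le_exp_neg q]
  rw [h1, measureReal_def, hindep.measure_inter_preimage_eq_mul S fun _ _ => measurableSet_Iic,
    ENNReal.toReal_prod]
  calc ∏ v ∈ S, P.real (X v ⁻¹' Set.Iic u) ≤ ∏ v ∈ S, Real.exp (-q) :=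
        Finset.prod_le_prod (fun _ _ => measureReal_nonneg) fun v _ => h2 v
    _ = Real.exp (-(S.card * q)) := by
        rw [Finset.prod_const, ← Real.exp_nat_mul, mul_neg]

theorem measureReal_le_sum_sq_le {n : ℕ} (hn : n ≠ 0) {X : Fin n → Ω → ℝ}
    (hlaw : ∀ v, HasLaw (X v) (gaussianReal 0 (Real.toNNReal (s ^ 2))) P) {e : ℝ} (he : 0 < e) :
    P.real {ω | e ^ 2 * n ≤ ∑ v, X v ω ^ 2} ≤ s ^ 2 / e ^ 2 := by
  have hn' : (0 : ℝ) < n := by positivity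
  have hL v := memLp_two_of_hasLaw_gaussianReal (hlaw v)
  have hint : ∀ v, ∫ ω, X v ω ^ 2 ∂P = s ^ 2 := by
    intro v
    have h0 : ∫ ω, X v ω ∂P = 0 := by
      rw [(hlaw v).integral_eq]
      simp
    rw [← variance_of_integral_eq_zero (hlaw v).aemeasurable h0, (hlaw v).variance_eq,
      variance_id_gaussianReal, Real.coe_toNNReal _ (sq_nonneg s)]
  have h := mul_meas_ge_le_integral_of_nonneg (μ := P) (f := fun ω => ∑ v, X v ω ^ 2)
    (ae_of_all _ fun ω => Finset.sum_nonneg fun v _ => sq_nonneg _)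
    (integrable_finsetSum _ fun v _ => (hL v).integrable_sq) (e ^ 2 * n)
  rw [integral_finsetSum _ fun v _ => (hL v).integrable_sq] at h
  simp only [hint, Finset.sum_const, Finset.card_univ, Fintype.card_fin, nsmul_eq_mul] at h
  rw [le_div_iff₀ (by positivity)]
  nlinarith

end Tails

/-! ### Bounds on the probability of exact recovery -/

section Recovery

variable {Ω : Type*} [MeasurableSpace Ω] {n : ℕ} {P : Measure Ω} [IsProbabilityMeasure P]
  {ξ : Fin n → Ω → ℝ} {s : ℝ}

theorem isMLE_observation_iff (hs : 0 < s) (hn : n ≠ 0)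
    (hlaw : ∀ v, HasLaw (ξ v) (gaussianReal 0 (Real.toNNReal (s ^ 2))) P)
    (hindep : iIndepFun ξ P) (y z : Assignment n) (ω : Ω) :
    IsMLE P ξ (observation ξ y ω) z ↔
      ∀ x, ∑ v, (ξ v ω + (profile y v - profile z v)) ^ 2 ≤
        ∑ v, (ξ v ω + (profile y v - profile x v)) ^ 2 := by
  unfold IsMLE
  simp only [objective_observation hs.ne' hn hlaw hindep]
  exact forall_congr' fun x => mul_le_mul_iff_right₀ (by positivity)

/-- Recovery fails as soon as some noise value exceeds `c / 2` in the second community and some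
noise value is below `-c / 2` in the first one. -/
theorem measureReal_mem_equivClass_le (hs : 0 < s) (hn : n ≠ 0)
    (hlaw : ∀ v, HasLaw (ξ v) (gaussianReal 0 (Real.toNNReal (s ^ 2))) P)
    (hindep : iIndepFun ξ P) {y : Assignment n} {yhat : Ω → Assignment n}
    (hyhat : ∀ ω, IsMLE P ξ (observation ξ y ω) (yhat ω)) {c : ℝ}
    (hy : 0 < 2 * share y - 1) (hc : 2 * share y - 1 ≤ c) {r : ℝ}
    (hr : ∀ a, r ≤ communitySize y a) :
    P.real {ω | yhat ω ∈ equivClass y} ≤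
      2 * Real.exp (-(r * ((√(2 * Real.pi))⁻¹ * Real.exp (-(c / 2 / s + 1) ^ 2 / 2)))) := by
  set q := (√(2 * Real.pi))⁻¹ * Real.exp (-(c / 2 / s + 1) ^ 2 / 2) with hq
  have hq0 : 0 < q := by positivity
  have hc0 : 0 ≤ c / 2 := by linarith
  have hsub : {ω | yhat ω ∈ equivClass y} ⊆
      {ω | ∀ v ∈ Finset.univ.filter (fun v => y v = 1), ξ v ω ≤ c / 2} ∪
        {ω | ∀ v ∈ Finset.univ.filter (fun v => y v = 0), (-ξ v) ω ≤ c / 2} := by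
    intro ω hω
    have hfit : ∀ x, ∑ v, ξ v ω ^ 2 ≤ ∑ v, (ξ v ω + (profile y v - profile x v)) ^ 2 := by
      intro x
      have := (isMLE_observation_iff hs hn hlaw hindep y _ ω).1 (hyhat ω) x
      rw [profile_congr (mem_equivClass_iff.1 hω)] at this
      simpa using this
    by_contra hcon
    simp only [Set.mem_union, Set.mem_ofPred_eq, Finset.mem_filter, Finset.mem_univ, true_and,
      Pi.neg_apply, not_or, not_forall, not_le] at hcon
    obtain ⟨⟨j, hj, hj'⟩, i, hi, hi'⟩ := hcon
    have := noise_sub_le_of_forall_le hy hfit hi (by rw [hj]; decide : y j ≠ 0)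
    linarith
  have hneg : ∀ v, HasLaw (-ξ v) (gaussianReal 0 (Real.toNNReal (s ^ 2))) P := fun v => by
    simpa using gaussianReal_neg (hlaw v)
  have hindep' : iIndepFun (fun v => -ξ v) P :=
    hindep.comp (fun _ x => -x) fun _ => measurable_neg
  have hexp : ∀ a, Real.exp (-(((Finset.univ.filter fun v => y v = a).card : ℝ) * q)) ≤
      Real.exp (-(r * q)) := fun a =>
    Real.exp_le_exp.2 (neg_le_neg (mul_le_mul_of_nonneg_right (hr a) hq0.le))
  have h1 := measureReal_forall_le (Finset.univ.filter fun v => y v = 1) hs hlaw hindep hc0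
  have h2 := measureReal_forall_le (Finset.univ.filter fun v => y v = 0) hs hneg hindep' hc0
  calc P.real {ω | yhat ω ∈ equivClass y} ≤ _ := measureReal_mono hsub
    _ ≤ _ := measureReal_union_le _ _
    _ ≤ 2 * Real.exp (-(r * q)) := by
      linarith [h1.trans (hexp 1), h2.trans (hexp 0)]

/-- Recovery succeeds when all noise values are at most `m` in absolute value and their mean
square is at most `e²`. The event of recovery need not be measurable, so its probability is
bounded below through the subadditivity of the outer measure. -/
theorem le_measureReal_mem_equivClass (hs : 0 < s) (hn : n ≠ 0)
    (hlaw : ∀ v, HasLaw (ξ v) (gaussianReal 0 (Real.toNNReal (s ^ 2))) P)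
    (hindep : iIndepFun ξ P) {y : Assignment n} {yhat : Ω → Assignment n}
    (hyhat : ∀ ω, IsMLE P ξ (observation ξ y ω) (yhat ω)) {e m : ℝ}
    (he : 0 < e) (hm : 0 ≤ m) (hy : 0 < 2 * share y - 1)
    (hgap : 0 < (2 * share y - 1) ^ 2 - 2 * m * (2 * share y - 1) - 20 * e) :
    1 - (n * (2 * Real.exp (-m ^ 2 / (2 * s ^ 2))) + s ^ 2 / e ^ 2) ≤
      P.real {ω | yhat ω ∈ equivClass y} := by
  have hcov : (Set.univ : Set Ω) ⊆ {ω | yhat ω ∈ equivClass y} ∪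
      ((⋃ v ∈ Finset.univ, {ω | m ≤ |ξ v ω|}) ∪ {ω | e ^ 2 * n ≤ ∑ v, ξ v ω ^ 2}) := by
    intro ω _
    by_contra hcon
    simp only [Set.mem_union, Set.mem_iUnion, Set.mem_ofPred_eq, not_or, not_exists, not_le,
      Finset.mem_univ, true_and, exists_prop] at hcon
    obtain ⟨h1, h2, h3⟩ := hcon
    refine h1 (mem_equivClass_of_fit_le hn he.le hy (fun v => (h2 v).le) h3.le hgap ?_)
    simpa using (isMLE_observation_iff hs hn hlaw hindep y _ ω).1 (hyhat ω) y
  have h1 : P.real (⋃ v ∈ Finset.univ, {ω | m ≤ |ξ v ω|}) ≤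
      n * (2 * Real.exp (-m ^ 2 / (2 * s ^ 2))) := by
    refine (measureReal_biUnion_finset_le _ _).trans ?_
    refine (Finset.sum_le_sum fun v _ => measureReal_le_abs_le (hlaw v) hm).trans ?_
    simp
  have h2 := measureReal_le_sum_sq_le hn hlaw he
  have h3 := (measureReal_mono hcov (measure_ne_top P _)).trans (measureReal_union_le _ _)
  rw [probReal_univ] at h3
  have h4 := measureReal_union_le (μ := P) (⋃ v ∈ Finset.univ, {ω | m ≤ |ξ v ω|})
    {ω | e ^ 2 * n ≤ ∑ v, ξ v ω ^ 2}
  linarith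

end Recovery

/-! ### Asymptotics -/

theorem tendsto_sqrt_two_mul_log :
    Tendsto (fun n : ℕ => √(2 * Real.log n)) atTop atTop :=
  Real.tendsto_sqrt_atTop.comp
    ((Real.tendsto_log_atTop.comp tendsto_natCast_atTop_atTop).const_mul_atTop two_pos)

theorem sqrt_eight_mul_log (n : ℕ) : √(8 * Real.log n) = 2 * √(2 * Real.log n) := by
  rw [show 8 * Real.log n = 2 ^ 2 * (2 * Real.log n) by ring, Real.sqrt_mul (by positivity),
    Real.sqrt_sq two_pos.le]

theorem sq_sqrt_two_mul_log (n : ℕ) : √(2 * Real.log n) ^ 2 = 2 * Real.log n :=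
  Real.sq_sqrt (mul_nonneg two_pos.le (Real.log_natCast_nonneg n))

/-- If `ρ < 1`, then the expected number of `n` standard Gaussian variables that exceed
`ρ √(2 log n)` tends to infinity. -/
theorem tendsto_mul_exp_atTop {ρ : ℝ} (hρ0 : 0 ≤ ρ) (hρ : ρ < 1) :
    Tendsto (fun n : ℕ => (n : ℝ) * Real.exp (-(ρ * √(2 * Real.log n) + 1) ^ 2 / 2))
      atTop atTop := by
  have hl := tendsto_sqrt_two_mul_log
  have h1 : Tendsto (fun n : ℕ => (1 - ρ) * √(2 * Real.log n) + -1) atTop atTop :=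
    tendsto_atTop_add_const_right _ _ (hl.const_mul_atTop (by linarith))
  have h2 : Tendsto (fun n : ℕ => (1 + ρ) * √(2 * Real.log n) + 1) atTop atTop :=
    tendsto_atTop_add_const_right _ _ (hl.const_mul_atTop (by linarith))
  refine (Real.tendsto_exp_atTop.comp
    ((h1.atTop_mul_atTop₀ h2).const_mul_atTop (by norm_num : (0 : ℝ) < 1 / 2))).congr' ?_
  filter_upwards [eventually_gt_atTop 0] with n hn
  have hn' : (0 : ℝ) < n := by exact_mod_cast hn
  have hsq := sq_sqrt_two_mul_log n
  rw [Function.comp_apply, ← Real.exp_log hn', ← Real.exp_add, Real.exp_log hn', Real.exp_eq_exp]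
  linear_combination hsq / 2

/-- If `κ > 1`, then `n` events of probability at most `n ^ (-κ)` have a negligible union. -/
theorem tendsto_mul_exp_neg_mul_log {κ : ℝ} (hκ : 1 < κ) :
    Tendsto (fun n : ℕ => (n : ℝ) * (2 * Real.exp (-(κ * Real.log n)))) atTop (𝓝 0) := by
  have h1 : Tendsto (fun n : ℕ => 2 * Real.exp (-((κ - 1) * Real.log n))) atTop (𝓝 (2 * 0)) :=
    (Real.tendsto_exp_neg_atTop_nhds_zero.comp
      ((Real.tendsto_log_atTop.comp tendsto_natCast_atTop_atTop).const_mul_atTop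
        (by linarith : 0 < κ - 1))).const_mul 2
  rw [mul_zero] at h1
  refine h1.congr' ?_
  filter_upwards [eventually_gt_atTop 0] with n hn
  have hn' : (0 : ℝ) < n := by exact_mod_cast hn
  rw [show -((κ - 1) * Real.log n) = Real.log n + -(κ * Real.log n) by ring, Real.exp_add,
    Real.exp_log hn']
  ring

theorem share_mem_Icc {α : ℝ} (hα : 0 ≤ α) {n : ℕ} (hn : n ≠ 0) {x : Assignment n}
    (hx : communitySize x 0 = ⌊α * n⌋₊) :
    2 * share x - 1 ∈ Set.Icc (2 * α - 1 - 2 / n) (2 * α - 1) := by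
  have hn' : (0 : ℝ) < n := by positivity
  have h1 : (⌊α * n⌋₊ : ℝ) ≤ α * n := Nat.floor_le (by positivity)
  have h2 : α * n < ⌊α * n⌋₊ + 1 := Nat.lt_floor_add_one _
  have h3 : share x ≤ α := by
    rw [share, hx, div_le_iff₀ hn']
    exact h1
  have h4 : α - 1 / n ≤ share x := by
    rw [share, hx, le_div_iff₀ hn', sub_mul, one_div, inv_mul_cancel₀ hn'.ne']
    linarith
  have h5 : (2 : ℝ) / n = 2 * (1 / n) := by ring
  constructor <;> linarith

theorem third_le_communitySize {α : ℝ} (hα : α ∈ Set.Ioo (1 / 2 : ℝ) (2 / 3)) {n : ℕ}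
    (hn : 6 ≤ n) {x : Assignment n} (h0 : communitySize x 0 = ⌊α * n⌋₊)
    (a : Fin 2) : (n : ℝ) / 3 ≤ communitySize x a := by
  have hn' : (6 : ℝ) ≤ n := by exact_mod_cast hn
  have hα0 : 0 ≤ α * n := mul_nonneg (by linarith [hα.1]) (by positivity)
  have h1 : (⌊α * n⌋₊ : ℝ) ≤ α * n := Nat.floor_le hα0
  have h2 : α * n < ⌊α * n⌋₊ + 1 := Nat.lt_floor_add_one _
  have h3 : (communitySize x 0 : ℝ) + communitySize x 1 = n := by
    exact_mod_cast communitySize_zero_add_one x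
  have e0 : (communitySize x 0 : ℝ) = ⌊α * n⌋₊ := by rw [h0]
  match a with
  | 0 => nlinarith [hα.1]
  | 1 => nlinarith [hα.2]

end VertexNoise

/-! ### The sharp threshold -/

theorem mainTheorem6 (α : ℝ) (hα : α ∈ Set.Ioo (1 / 2 : ℝ) (2 / 3)) (δ : ℝ) (hδ : 0 < δ)
    (s : ℕ → ℝ) (hs : ∀ n, 0 < s n)
    (Ω : ℕ → Type*) [∀ n, MeasurableSpace (Ω n)]
    (P : ∀ n, Measure (Ω n)) [∀ n, IsProbabilityMeasure (P n)]
    (ξ : ∀ n, Fin n → Ω n → ℝ)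
    (hξ_law : ∀ n v, HasLaw (ξ n v) (gaussianReal 0 (Real.toNNReal (s n ^ 2))) (P n))
    (hξ_indep : ∀ n, iIndepFun (ξ n) (P n))
    (y : ∀ n, VertexNoise.Assignment n)
    (hy : ∀ n, VertexNoise.communitySize (y n) 0 = ⌊α * n⌋₊ ∧
      VertexNoise.communitySize (y n) 1 = n - ⌊α * n⌋₊)
    (yhat : ∀ n, Ω n → VertexNoise.Assignment n)
    (hyhat : ∀ n ω,
      VertexNoise.IsMLE (P n) (ξ n) (VertexNoise.observation (ξ n) (y n) ω) (yhat n ω)) :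
    ((∀ᶠ n : ℕ in atTop, (1 + δ) * (2 * α - 1) / √(8 * Real.log n) < s n) →
      Tendsto (fun n => P n {ω | yhat n ω ∈ VertexNoise.equivClass (y n)}) atTop (𝓝 0)) ∧
    ((∀ᶠ n : ℕ in atTop, s n < (1 - δ) * (2 * α - 1) / √(8 * Real.log n)) →
      Tendsto (fun n => P n {ω | yhat n ω ∈ VertexNoise.equivClass (y n)}) atTop (𝓝 1)) := by
  have hα0 : 0 ≤ α := by linarith [hα.1]
  set c := 2 * α - 1 with hc_def
  have hc : 0 < c := by linarith [hα.1]
  have hl := VertexNoise.tendsto_sqrt_two_mul_log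
  have hlim : Tendsto (fun n : ℕ => c - 2 / (n : ℝ)) atTop (𝓝 c) := by
    simpa using (tendsto_const_div_atTop_nhds_zero_nat (2 : ℝ)).const_sub c
  constructor
  · intro hlarge
    have hρ1 : 1 / (1 + δ) < 1 := by
      rw [div_lt_one (by linarith)]
      linarith
    have hbound : Tendsto (fun n : ℕ => 2 * Real.exp (-(1 / 3 * (√(2 * Real.pi))⁻¹ *
        ((n : ℝ) * Real.exp (-(1 / (1 + δ) * √(2 * Real.log n) + 1) ^ 2 / 2)))))
        atTop (𝓝 0) := by
      have := (Real.tendsto_exp_neg_atTop_nhds_zero.comp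
        ((VertexNoise.tendsto_mul_exp_atTop (by positivity) hρ1).const_mul_atTop
          (by positivity : 0 < 1 / 3 * (√(2 * Real.pi))⁻¹))).const_mul 2
      rwa [mul_zero] at this
    rw [← ENNReal.tendsto_toReal_iff (fun n => measure_ne_top _ _) ENNReal.zero_ne_top,
      ENNReal.toReal_zero]
    refine squeeze_zero' (Eventually.of_forall fun n => ENNReal.toReal_nonneg) ?_ hbound
    filter_upwards [hlarge, eventually_ge_atTop 6, hl.eventually_gt_atTop 0,
      hlim.eventually_const_lt hc] with n hn h6 hl0 hcn
    have hn0 : n ≠ 0 := by omega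
    have hsh := VertexNoise.share_mem_Icc hα0 hn0 (hy n).1
    refine (VertexNoise.measureReal_mem_equivClass_le (hs n) hn0 (hξ_law n) (hξ_indep n) (hyhat n)
      (hcn.trans_le hsh.1) hsh.2 (VertexNoise.third_le_communitySize hα h6 (hy n).1)).trans ?_
    -- The standardized level `c / (2 s)` is below `√(2 log n) / (1 + δ)`.
    have hz : c / 2 / s n ≤ 1 / (1 + δ) * √(2 * Real.log n) := by
      rw [VertexNoise.sqrt_eight_mul_log, div_lt_iff₀ (by positivity)] at hn
      rw [div_le_iff₀ (hs n), one_div, mul_assoc, ← div_eq_inv_mul, le_div_iff₀ (by linarith)]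
      linarith
    have hz0 : 0 ≤ c / 2 / s n := div_nonneg (by linarith) (hs n).le
    rw [show (n : ℝ) / 3 * ((√(2 * Real.pi))⁻¹ * Real.exp (-(c / 2 / s n + 1) ^ 2 / 2)) =
      1 / 3 * (√(2 * Real.pi))⁻¹ * (n * Real.exp (-(c / 2 / s n + 1) ^ 2 / 2)) by ring]
    gcongr
  · intro hsmall
    rcases le_or_gt 1 δ with hδ1 | hδ1
    · -- For `δ ≥ 1` the upper bound on `s` is not positive, so no such `s` exists.
      obtain ⟨n, hn⟩ := hsmall.exists
      have : (1 - δ) * c / √(8 * Real.log n) ≤ 0 :=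
        div_nonpos_of_nonpos_of_nonneg (mul_nonpos_of_nonpos_of_nonneg (by linarith) hc.le)
          (Real.sqrt_nonneg _)
      linarith [hs n]
    -- The noise level `m` lies strictly between `s √(2 log n)` and `c / 2`.
    set m := (1 - δ / 2) * c / 2 with hm_def
    have hm : 0 < m := by
      have : 0 < 1 - δ / 2 := by linarith
      positivity
    -- The gap `c² - 2 m c` is eventually at least `c² δ / 8`, and `20 e` is smaller than this.
    set e := c ^ 2 * δ / 200 with he_def
    have he : 0 < e := by positivity
    set κ := ((1 - δ / 2) / (1 - δ)) ^ 2 with hκ_def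
    have hκ : 1 < κ := by
      have : 1 < (1 - δ / 2) / (1 - δ) := by
        rw [one_lt_div (by linarith)]
        linarith
      exact one_lt_pow₀ this two_ne_zero
    have hs0 : Tendsto s atTop (𝓝 0) := by
      have h1 : Tendsto (fun n : ℕ => (1 - δ) * c / √(8 * Real.log n)) atTop (𝓝 0) := by
        simp only [VertexNoise.sqrt_eight_mul_log]
        exact tendsto_const_nhds.div_atTop (hl.const_mul_atTop two_pos)
      exact squeeze_zero' (Eventually.of_forall fun n => (hs n).le)
        (hsmall.mono fun n hn => hn.le) h1
    have hbound : Tendsto (fun n : ℕ => 1 - ((n : ℝ) * (2 * Real.exp (-(κ * Real.log n))) +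
        s n ^ 2 / e ^ 2)) atTop (𝓝 1) := by
      have h1 := (VertexNoise.tendsto_mul_exp_neg_mul_log hκ).add
        ((hs0.pow 2).div_const (e ^ 2))
      simpa using h1.const_sub 1
    rw [← ENNReal.tendsto_toReal_iff (fun n => measure_ne_top _ _) ENNReal.one_ne_top,
      ENNReal.toReal_one]
    refine tendsto_of_tendsto_of_tendsto_of_le_of_le' hbound tendsto_const_nhds ?_
      (Eventually.of_forall fun n => measureReal_le_one)
    filter_upwards [hsmall, eventually_gt_atTop 0, hl.eventually_gt_atTop 0,
      hlim.eventually_const_lt (by nlinarith : (1 - δ / 4) * c < c)] with n hn h0 hl0 hcn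
    have hsh := VertexNoise.share_mem_Icc hα0 h0.ne' (hy n).1
    have hlow : (1 - δ / 4) * c < 2 * VertexNoise.share (y n) - 1 := hcn.trans_le hsh.1
    set b := 2 * VertexNoise.share (y n) - 1
    have hhalf : 1 / 2 * c ≤ (1 - δ / 4) * c := mul_le_mul_of_nonneg_right (by linarith) hc.le
    have hgap : 0 < b ^ 2 - 2 * m * b - 20 * e := by
      have h1 : δ / 4 * c ≤ b - 2 * m := by
        rw [hm_def]
        linarith
      have h2 := mul_le_mul (hhalf.trans hlow.le) h1 (by positivity) (by linarith)
      have h3 : 0 < c ^ 2 * δ := by positivity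
      rw [he_def]
      nlinarith
    refine le_trans ?_ (VertexNoise.le_measureReal_mem_equivClass (hs n) h0.ne' (hξ_law n)
      (hξ_indep n) (hyhat n) he hm.le (by linarith) hgap)
    have hexp : -m ^ 2 / (2 * s n ^ 2) ≤ -(κ * Real.log n) := by
      rw [neg_div, neg_le_neg_iff, le_div_iff₀ (by have := hs n; positivity)]
      rw [VertexNoise.sqrt_eight_mul_log, lt_div_iff₀ (by positivity)] at hn
      have hsl : s n * √(2 * Real.log n) ≤ (1 - δ) * c / 2 := by linarith
      have h1 : (s n * √(2 * Real.log n)) ^ 2 ≤ ((1 - δ) * c / 2) ^ 2 :=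
        pow_le_pow_left₀ (mul_nonneg (hs n).le hl0.le) hsl 2
      rw [mul_pow, VertexNoise.sq_sqrt_two_mul_log] at h1
      have h2 : κ * ((1 - δ) * c / 2) ^ 2 = m ^ 2 := by
        have : 1 - δ ≠ 0 := by linarith
        rw [hκ_def, hm_def]
        field_simp
      calc κ * Real.log n * (2 * s n ^ 2) = κ * (s n ^ 2 * (2 * Real.log n)) := by ring
        _ ≤ κ * ((1 - δ) * c / 2) ^ 2 := mul_le_mul_of_nonneg_left h1 (by linarith)
        _ = m ^ 2 := h2
    gcongr
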